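/- Consider a school choice problem with a finite set $\mathcal I$ of students, a finite set $\mathcal S$ of schools and a finite set $\mathcal M$ of student types. Student $i$ has type $\tau(i)\in\mathcal M$ and a strict preference relation $P_i$ (a strict total order) over $\mathcal S\cup\{\emptyset\}$, where $\emptyset$ stands for being unmatched and $s$ is acceptable to $i$ if $s\,P_i\,\emptyset$; $R_i$ is the associated weak preference. School $s$ has capacity $q_s$, a reserve quota $q_s^m$ for each type $m$, with $\sum_m q^m_s<q_s$ and $q^m_s<|\{i:\tau(i)=m\}|$, the open quota $q^o_s=q_s-\sum_m q_s^m$, and a strict priority order over students, given by pairwise distinct priority scores. Each school $s$ is divided into an open subschool $s^o$ and a reserved subschool $s^r$. A strategy of a student is a preference list of subschools: a list without repetitions, best first, where unlisted subschools are reported as unacceptable. SimSep and SimFlex are the student-proposing deferred acceptance mechanisms over these lists: in each round each unassigned student applies to the first subschool on her list that has not rejected her, and each school $s$ selects tentatively from the set $I$ of students applying to or held by $s^o$ and the set $I'$ of students applying to or held by $s^r$, rejecting the others, until there are no more rejections. In both mechanisms, for each type $m$, $s^r$ selects the highest-ranked type-$m$ students of $I'$ up to the quota $q_s^m$. In SimSep,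 $s^o$ selects the highest-ranked students of $I$ up to the quota $q^o_s$; in SimFlex, it selects the highest-ranked students of $I$ up to the number of seats, out of $q_s$, that are left after the reserved selection. A list is consistent with $P_i$ if it contains both subschools of every acceptable school and no subschool of an unacceptable school, ranks $s^o$ and $s^r$ adjacently (in either order) for every acceptable $s$, and orders schools as $P_i$ does. A strategy of $i$ is weakly dominant if, whatever lists the other students submit, it gives $i$ a school (or $\emptyset$) that is at least as good under $P_i$ as the one she gets from any other list. A matching assigns to each student a school and a seat type (open or reserved), or leaves her unmatched, such that each school $s$ admits at most $q_s$ students and at most $q_s^m$ type-$m$ students in reserved seats. A matching $\mu$ is stable if $\mu(i)\,R_i\,\emptyset$ for all $i$; whenever $s\,P_i\,\mu(i)$, school $s$ admits exactly $q_s$ students and has exactly $q_s^{\tau(i)}$ students of type $\tau(i)$ in reserved seats; and there are no students $i,j$ such that $j$ is admitted to a school $s$ with $s\,P_i\,\mu(i)$, $i$ has higher priority than $j$ at $s$, and either $\tau(i)=\tau(j)$ or $j$ occupies an open seat. **Proposition.** In SimSep and in SimFlex, it is a weakly dominant strategy for every student to submit any preference list of subschools that is consistent with her true preferences. When all students submit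 lists consistent with their true preferences, and more generally when all students play weakly dominant strategies, the result of SimFlex is a stable matching. -/

import Mathlib

namespace SchoolChoice

/-- The two types of seats. -/
inductive Seat
  | opn
  | res
  deriving DecidableEq

instance : Fintype Seat where
  elems := {Seat.opn, Seat.res}
  complete := fun t => by cases t <;> decide

/-- A school choice problem with reserve quotas, without the preferences of the students.
`I` is the set of students, `S` the set of schools, `M` the set of student types. -/
structure Problem (I S M : Type*) [Fintype I] [Fintype M] [DecidableEq M] where
  /-- capacities `q_s` -/
  q : S → ℕ
  /-- reserve quotas `q^m_s` -/
  qr : S → M → ℕ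
  /-- types of the students -/
  τ : I → M
  /-- priority scores `π_{i,s}`; student `i` has higher priority than `j` at `s`
  iff `π j s < π i s` -/
  π : I → S → ℕ
  /-- the priorities of each school are strict -/
  π_inj : ∀ s, Function.Injective fun i => π i s
  /-- every school has an open seat -/
  sum_qr_lt : ∀ s, ∑ m, qr s m < q s
  /-- reserve quotas are smaller than the number of students of the type -/
  qr_lt_card : ∀ s m, qr s m < (Finset.univ.filter fun i => τ i = m).card

/-- The subschools `s^o = (s, opn)` and `s^r = (s, res)`. -/
abbrev Subschool (S : Type*) := S × Seat

/-- A preference list of subschools: a finite list without repetitions, best first.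
A subschool that is not listed is reported as unacceptable. -/
abbrev PrefList (S : Type*) := {L : List (Subschool S) // L.Nodup}

/-- A matching: the subschool (school and seat type) of each student, `none` if unmatched. -/
abbrev Matching (I S : Type*) := I → Option (Subschool S)

/-- A school's choice rule: from the disjoint sets of applicants to its open and to its reserved
subschool, it selects the students who get a seat of each type. -/
abbrev ChoiceRule (I : Type*) := Finset I → Finset I → Seat → Finset I

/-- A mechanism in which students submit preference lists of subschools. -/
abbrev Mechanism (I S : Type*) := (I → PrefList S) → Matching I S

section Matchings

variable {I S : Type*}

/-- The school (or the null school) of student `i`. -/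
def Matching.school (μ : Matching I S) (i : I) : Option S := (μ i).map Prod.fst

variable [Fintype I] [DecidableEq S]

/-- The students admitted to `s`. -/
def Matching.admitted (μ : Matching I S) (s : S) : Finset I :=
  Finset.univ.filter fun i => μ.school i = some s

/-- The type-`m` students who occupy reserved seats of `s`. -/
def Matching.reservedOf {M : Type*} [DecidableEq M] (μ : Matching I S) (τ : I → M) (s : S) (m : M) :
    Finset I :=
  Finset.univ.filter fun i => μ i = some (s, Seat.res) ∧ τ i = m

end Matchings

/-- The weak preference `R` of a strict preference `P`. -/
def WeakPref {α : Type*} (P : α → α → Prop) (a b : α) : Prop := P a b ∨ a = b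

/-- The list `L` is consistent with the preference `P` over schools and the null school `none`:
it contains exactly the subschools of the acceptable schools, with the two subschools of a school
ranked adjacently (in either order), and with the schools in the same order as in `P`. -/
structure PrefList.ConsistentWith {S : Type*} (L : PrefList S) (P : Option S → Option S → Prop) :
    Prop where
  mem_iff : ∀ s t, (s, t) ∈ L.1 ↔ P (some s) none
  adjacent : ∀ s, P (some s) none →
    [(s, Seat.opn), (s, Seat.res)] <:+: L.1 ∨ [(s, Seat.res), (s, Seat.opn)] <:+: L.1
  order : L.1.Pairwise fun x y => x.1 ≠ y.1 → P (some x.1) (some y.1)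

/-- In the mechanism `ψ`, submitting `L` is weakly dominant for student `i` with preference `P`:
whatever the others submit, no list gives her a school that she prefers. -/
def IsWeaklyDominant {I S : Type*} [DecidableEq I] (ψ : Mechanism I S)
    (P : Option S → Option S → Prop) (i : I) (L : PrefList S) : Prop :=
  ∀ (σ : I → PrefList S) (L' : PrefList S),
    WeakPref P (Matching.school (ψ (Function.update σ i L)) i)
      (Matching.school (ψ (Function.update σ i L')) i)

section DA

variable {I S : Type*} [Fintype I] [DecidableEq I] [Fintype S] [DecidableEq S]

/-- The subschool to which student `i` applies (or which tentatively holds her):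
the best one on her list that has not rejected her. `R` is the set of all rejections so far. -/
def offer (σ : I → PrefList S) (R : Finset (I × Subschool S)) (i : I) : Option (Subschool S) :=
  (σ i).1.find? fun x => decide ((i, x) ∉ R)

/-- The students applying to, or tentatively held by, a subschool. -/
def applicants (σ : I → PrefList S) (R : Finset (I × Subschool S)) (x : Subschool S) : Finset I :=
  Finset.univ.filter fun i => offer σ R i = some x

/-- One round of deferred acceptance: every school applies its choice rule to the students who are
applying to it or tentatively held by it; those not chosen for the seat are rejected. -/
def daRound (C : S → ChoiceRule I) (σ : I → PrefList S) (R : Finset (I × Subschool S)) :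
    Finset (I × Subschool S) :=
  R ∪ Finset.univ.filter fun p =>
    p.1 ∈ applicants σ R p.2 ∧
      p.1 ∉ C p.2.1 (applicants σ R (p.2.1, Seat.opn)) (applicants σ R (p.2.1, Seat.res)) p.2.2

/-- All rejections made by deferred acceptance. Each round before the algorithm stops makes a new
rejection, so that `|I × Subschool S|` rounds are enough; see `daRound_daRejections`. -/
def daRejections (C : S → ChoiceRule I) (σ : I → PrefList S) : Finset (I × Subschool S) :=
  (daRound C σ)^[Fintype.card (I × Subschool S)] ∅

/-- The algorithm has stopped: a further round changes nothing. -/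
theorem daRound_daRejections (C : S → ChoiceRule I) (σ : I → PrefList S) :
    daRound C σ (daRejections C σ) = daRejections C σ := by
  by_contra hne
  have key : ∀ k, k ≤ Fintype.card (I × Subschool S) + 1 → k ≤ ((daRound C σ)^[k] ∅).card := by
    intro k
    induction k with
    | zero => intro _; exact Nat.zero_le _
    | succ k ih =>
      intro hk
      have h1 := ih (by omega)
      have hsub : (daRound C σ)^[k] ∅ ⊆ (daRound C σ)^[k + 1] ∅ := by
        rw [Function.iterate_succ_apply']
        exact Finset.subset_union_left
      have hneq : (daRound C σ)^[k] ∅ ≠ (daRound C σ)^[k + 1] ∅ := by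
        intro h
        rw [Function.iterate_succ_apply'] at h
        apply hne
        obtain ⟨d, hd⟩ := Nat.exists_eq_add_of_le (show k ≤ Fintype.card (I × Subschool S) by omega)
        have hfix : (daRound C σ)^[Fintype.card (I × Subschool S)] ∅ = (daRound C σ)^[k] ∅ := by
          rw [hd, Nat.add_comm, Function.iterate_add_apply]
          exact Function.iterate_fixed h.symm d
        rw [daRejections, hfix]
        exact h.symm
      have := Finset.card_lt_card (Finset.ssubset_iff_subset_ne.2 ⟨hsub, hneq⟩)
      omega
  have h := key _ le_rfl
  have := Finset.card_le_univ ((daRound C σ)^[Fintype.card (I × Subschool S) + 1] ∅)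
  omega

/-- The student-proposing deferred acceptance mechanism with choice rules `C`. -/
def deferredAcceptance (C : S → ChoiceRule I) : Mechanism I S :=
  fun σ => offer σ (daRejections C σ)

end DA

namespace Problem

variable {I S M : Type*} [Fintype I] [DecidableEq I] [Fintype S] [DecidableEq S]
  [Fintype M] [DecidableEq M]

/-- The `n` highest-ranked students of `A` at `s` (all of `A` if there are fewer). -/
def top (E : Problem I S M) (s : S) (n : ℕ) (A : Finset I) : Finset I :=
  A.filter fun i => (A.filter fun j => E.π i s < E.π j s).card < n

/-- The applicants in `A` who get reserved seats of `s`: for each type `m`,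
the highest-ranked ones of type `m` up to the quota. -/
def chooseReserved (E : Problem I S M) (s : S) (A : Finset I) : Finset I :=
  Finset.univ.biUnion fun m => E.top s (E.qr s m) (A.filter fun i => E.τ i = m)

/-- The choice rule of SimSep: open seats and reserved seats are allocated separately. -/
def choiceSep (E : Problem I S M) (s : S) : ChoiceRule I
  | A, _, Seat.opn => E.top s (E.q s - ∑ m, E.qr s m) A
  | _, A', Seat.res => E.chooseReserved s A'

/-- The choice rule of SimFlex: after reserved seats have been allocated, all remaining seats are
allocated as open seats. -/
def choiceFlex (E : Problem I S M) (s : S) : ChoiceRule I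
  | A, A', Seat.opn => E.top s (E.q s - (E.chooseReserved s A').card) A
  | _, A', Seat.res => E.chooseReserved s A'

/-- The mechanism SimSep. -/
def simSep (E : Problem I S M) : Mechanism I S := deferredAcceptance E.choiceSep

/-- The mechanism SimFlex. -/
def simFlex (E : Problem I S M) : Mechanism I S := deferredAcceptance E.choiceFlex

/-- Capacities and reserve quotas are respected. -/
def IsFeasible (E : Problem I S M) (μ : Matching I S) : Prop :=
  (∀ s, (μ.admitted s).card ≤ E.q s) ∧ ∀ s m, (μ.reservedOf E.τ s m).card ≤ E.qr s m

/-- Student `i` has justified envy towards `j`. -/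
def JustifiedEnvy (E : Problem I S M) (P : I → Option S → Option S → Prop) (μ : Matching I S)
    (i j : I) : Prop :=
  ∃ s, μ.school j = some s ∧ P i (some s) (μ.school i) ∧ E.π j s < E.π i s ∧
    (E.τ i = E.τ j ∨ μ j = some (s, Seat.opn))

/-- `μ` is a stable matching under the preferences `P`. -/
structure IsStable (E : Problem I S M) (P : I → Option S → Option S → Prop) (μ : Matching I S) :
    Prop where
  feasible : E.IsFeasible μ
  individuallyRational : ∀ i, WeakPref (P i) (μ.school i) none
  nonWasteful : ∀ i s, P i (some s) (μ.school i) → (μ.admitted s).card = E.q s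
  reserveNonWasteful : ∀ i s, P i (some s) (μ.school i) →
    (μ.reservedOf E.τ s (E.τ i)).card = E.qr s (E.τ i)
  noJustifiedEnvy : ∀ i j, ¬ E.JustifiedEnvy P μ i j

end Problem

end SchoolChoice

/-! View each pair of a student and a subschool as a contract. A regular choice of contracts is
substitutable, so the map sending a set `R` of rejections to the contracts that are rejected once
everybody has worked down her list past `R` is monotone, and deferred acceptance computes its least
fixed point. By the law of aggregate demand all fixed points match the same students. Comparing
fixed points for lists that differ in one student shows that she cannot do better, in terms of
subschools, than by ranking them truthfully; a consistent list is truthful up to seats of the same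
school, which she does not care about.

For stability, let the other students list only their assignments. A student whose strategy is
weakly dominant still ends up at the same school, so that she is not selected for any better seat
that she could have listed instead. For SimFlex, not being selected means that the seats are filled
by students of higher priority. -/

namespace SchoolChoice

open Finset Function

section RegularChoice

variable {I X : Type*} [Fintype X]

/-- A choice operator on families of sets of applicants, indexed by positions `x : X`, is regular
if it selects among the applicants, is substitutable (a selected applicant remains selected when
competitors leave), and satisfies the law of aggregate demand. -/
structure IsRegularChoice (c : (X → Finset I) → X → Finset I) : Prop where
  le : ∀ Y, c Y ≤ Y
  mem_of_le : ∀ {Y Z x i}, Y ≤ Z → i ∈ Y x → i ∈ c Z x → i ∈ c Y x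
  sum_card_mono : Monotone fun Y => ∑ x, #(c Y x)

theorem IsRegularChoice.eq_of_le {c : (X → Finset I) → X → Finset I} (hc : IsRegularChoice c)
    {Y Z : X → Finset I} (hYZ : Y ≤ Z) (hZY : c Z ≤ Y) : c Y = c Z := by
  have hle : ∀ x, c Z x ⊆ c Y x := fun x i hi => hc.mem_of_le hYZ (hZY x hi) hi
  have hsum : ∑ x, #(c Z x) = ∑ x, #(c Y x) :=
    (sum_le_sum fun x _ => card_le_card (hle x)).antisymm (hc.sum_card_mono hYZ)
  have hcard := (sum_eq_sum_iff_of_le fun x _ => card_le_card (hle x)).1 hsum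
  exact funext fun x => (eq_of_subset_of_card_le (hle x) (hcard x (mem_univ x)).ge).symm

end RegularChoice

section JointChoice

variable {I S : Type*} {C : S → ChoiceRule I}

/-- A choice rule as an operator on families of sets of applicants indexed by the seat type. -/
def ChoiceRule.select (c : ChoiceRule I) (A : Seat → Finset I) : Seat → Finset I :=
  c (A Seat.opn) (A Seat.res)

/-- The students selected by each subschool when every school `s` applies its choice rule `C s` to
the sets `Y (s, t)` of applicants. -/
def jointChoice (C : S → ChoiceRule I) (Y : Subschool S → Finset I) (x : Subschool S) : Finset I :=
  (C x.1).select (fun t => Y (x.1, t)) x.2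

theorem jointChoice_congr {Y Z : Subschool S → Finset I} {x : Subschool S}
    (h : ∀ t, Y (x.1, t) = Z (x.1, t)) : jointChoice C Y x = jointChoice C Z x := by
  simp only [jointChoice, h]

theorem isRegularChoice_jointChoice [Fintype S] (hC : ∀ s, IsRegularChoice (C s).select) :
    IsRegularChoice (jointChoice C) where
  le _ x := (hC x.1).le _ x.2
  mem_of_le {_ _ x _} hYZ := (hC x.1).mem_of_le fun t => hYZ (x.1, t)
  sum_card_mono Y Z hYZ := by
    simp only [Fintype.sum_prod_type]
    exact sum_le_sum fun s _ => (hC s).sum_card_mono fun t => hYZ (s, t)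

end JointChoice

namespace Matching

variable {I S : Type*} [Fintype I] [DecidableEq S] (μ : Matching I S)

/-- The students assigned to the subschool `x`. -/
def holders (x : Subschool S) : Finset I := {i | μ i = some x}

variable {μ}

theorem mem_holders {x : Subschool S} {i : I} : i ∈ μ.holders x ↔ μ i = some x := by
  simp [holders]

theorem holders_update_le [DecidableEq I] {Y : Subschool S → Finset I} {i : I} {x : Subschool S}
    (hi : i ∈ Y x) (hY : ∀ j y, j ≠ i → μ j = some y → j ∈ Y y) :
    holders (update μ i (some x)) ≤ Y := by
  intro y j hj
  rw [mem_holders] at hj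
  by_cases hji : j = i
  · subst hji
    rw [update_self, Option.some_inj] at hj
    exact hj ▸ hi
  · rw [update_of_ne hji] at hj
    exact hY j y hji hj

theorem mem_update_insert_holders [DecidableEq I] {x y : Subschool S} {i j : I} :
    j ∈ update μ.holders x (insert i (μ.holders x)) y ↔ μ j = some y ∨ j = i ∧ y = x := by
  by_cases hy : y = x
  · subst hy
    simp [mem_holders, or_comm]
  · simp [mem_holders, hy]

theorem jointChoice_holders_update [DecidableEq I] {C : S → ChoiceRule I} {i : I} {x : Subschool S}
    (hi : μ.school i ≠ some x.1) :
    jointChoice C (holders (update μ i (some x))) x =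
      jointChoice C (update μ.holders x (insert i (μ.holders x))) x := by
  refine jointChoice_congr fun t => ?_
  have hit : μ i ≠ some (x.1, t) := fun h => hi (by simp [school, h])
  ext j
  rw [mem_update_insert_holders, mem_holders]
  by_cases hj : j = i
  · subst hj
    simp [hit, eq_comm]
  · simp [hj]

theorem sum_card_holders [Fintype S] (μ : Matching I S) :
    ∑ x, #(μ.holders x) = #{i | μ i ≠ none} := by
  simp only [holders, card_filter]
  rw [sum_comm]
  refine sum_congr rfl fun i _ => ?_
  cases μ i <;> simp

theorem card_admitted (μ : Matching I S) (s : S) :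
    #(μ.admitted s) = #(μ.holders (s, Seat.opn)) + #(μ.holders (s, Seat.res)) := by
  simp only [admitted, holders, card_filter, ← sum_add_distrib]
  refine sum_congr rfl fun i _ => ?_
  rw [school]
  rcases μ i with _ | ⟨s', _ | _⟩ <;> simp

theorem reservedOf_eq {M : Type*} [DecidableEq M] (μ : Matching I S) (τ : I → M) (s : S) (m : M) :
    μ.reservedOf τ s m = {i ∈ μ.holders (s, Seat.res) | τ i = m} := by
  simp only [reservedOf, holders, filter_filter]

/-- Pairwise stability in the sense of matching with contracts: students and schools do not want to
drop anyone, and no student would be selected for a seat at a school that she prefers if she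
applied for it in addition to the students assigned to it. -/
structure IsPairwiseStable [DecidableEq I] (C : S → ChoiceRule I)
    (P : I → Option S → Option S → Prop) (μ : Matching I S) : Prop where
  individuallyRational : ∀ i, WeakPref (P i) (μ.school i) none
  jointChoice_holders : jointChoice C μ.holders = μ.holders
  notMem_jointChoice_insert : ∀ i x, P i (some x.1) (μ.school i) →
    i ∉ jointChoice C (update μ.holders x (insert i (μ.holders x))) x

end Matching

section Offers

variable {I S : Type*} {σ σ' : I → PrefList S} {R R' : Finset (I × Subschool S)}
  {i : I} {x : Subschool S}

theorem offer_eq_none_iff [DecidableEq I] [DecidableEq S] :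
    offer σ R i = none ↔ ∀ a ∈ (σ i).1, (i, a) ∈ R := by
  simp [offer]

variable [Fintype I]

open Classical in
/-- The students who have applied to `x` at some point when `R` is the set of rejections: those who
have been rejected by all the subschools that they rank above `x`. -/
noncomputable def offers (σ : I → PrefList S) (R : Finset (I × Subschool S)) (x : Subschool S) :
    Finset I :=
  {i | ∃ as, as ++ [x] <+: (σ i).1 ∧ ∀ a ∈ as, (i, a) ∈ R}

theorem mem_offers :
    i ∈ offers σ R x ↔ ∃ as, as ++ [x] <+: (σ i).1 ∧ ∀ a ∈ as, (i, a) ∈ R := by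
  simp [offers]

theorem mem_offers_of_forall (hσ : σ i = σ' i) (hR : ∀ a, (i, a) ∈ R → (i, a) ∈ R')
    (hi : i ∈ offers σ R x) : i ∈ offers σ' R' x := by
  obtain ⟨as, has, hasR⟩ := mem_offers.1 hi
  exact mem_offers.2 ⟨as, hσ ▸ has, fun a ha => hR a (hasR a ha)⟩

theorem offers_mono (h : R ⊆ R') : offers σ R ≤ offers σ R' :=
  fun _ _ => mem_offers_of_forall rfl fun _ ha => h ha

theorem mem_offers_of_prefix (h : (σ i).1 <+: (σ' i).1) (hi : i ∈ offers σ R x) :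
    i ∈ offers σ' R x := by
  obtain ⟨as, has, hasR⟩ := mem_offers.1 hi
  exact mem_offers.2 ⟨as, has.trans h, hasR⟩

theorem mem_offers_iff_of_prefix (h : (σ i).1 <+: (σ' i).1) {z : Subschool S}
    (hz : z ∈ (σ i).1) (hzR : (i, z) ∉ R) : i ∈ offers σ' R x ↔ i ∈ offers σ R x := by
  refine ⟨fun hi => ?_, mem_offers_of_prefix h⟩
  obtain ⟨as, has, hasR⟩ := mem_offers.1 hi
  refine mem_offers.2 ⟨as, ?_, hasR⟩
  rcases List.prefix_or_prefix_of_prefix has h with hpre | hpre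
  · exact hpre
  rcases List.prefix_concat_iff.1 hpre with heq | hpre
  · exact heq ▸ List.prefix_rfl
  · exact absurd (hasR z (hpre.subset hz)) hzR

variable [DecidableEq I] [DecidableEq S]

theorem offer_eq_some_iff : offer σ R i = some x ↔ i ∈ offers σ R x ∧ (i, x) ∉ R := by
  rw [offer, List.find?_eq_some_iff_append, mem_offers, and_comm]
  refine and_congr ?_ (by simp)
  constructor
  · rintro ⟨as, bs, h, has⟩
    exact ⟨as, ⟨bs, by simp [h]⟩, by simpa using has⟩
  · rintro ⟨as, ⟨bs, h⟩, has⟩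
    exact ⟨as, bs, by simp [← h], by simpa using has⟩

theorem mem_applicants : i ∈ applicants σ R x ↔ i ∈ offers σ R x ∧ (i, x) ∉ R := by
  simp [applicants, offer_eq_some_iff]

theorem applicants_le_offers : applicants σ R ≤ offers σ R :=
  fun _ _ hi => (mem_applicants.1 hi).1

theorem holders_offer : Matching.holders (offer σ R) = applicants σ R := rfl

end Offers

section FixedPoint

variable {I S : Type*} [Fintype I] [DecidableEq I] [Fintype S]
  {C : S → ChoiceRule I} {σ σ' : I → PrefList S} {R R' : Finset (I × Subschool S)}
  {i : I} {x : Subschool S}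

/-- The pairs `(i, x)` such that `x` rejects `i` when it chooses among all students who have
applied to it, where `R` is the set of rejections so far. -/
noncomputable def rejectedOffers (C : S → ChoiceRule I) (σ : I → PrefList S)
    (R : Finset (I × Subschool S)) : Finset (I × Subschool S) :=
  {p | p.1 ∈ offers σ R p.2 ∧ p.1 ∉ jointChoice C (offers σ R) p.2}

theorem mem_rejectedOffers :
    (i, x) ∈ rejectedOffers C σ R ↔ i ∈ offers σ R x ∧ i ∉ jointChoice C (offers σ R) x := by
  simp [rejectedOffers]

theorem mem_iff_of_isFixedPt (hR : IsFixedPt (rejectedOffers C σ) R) :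
    (i, x) ∈ R ↔ i ∈ offers σ R x ∧ i ∉ jointChoice C (offers σ R) x := by
  rw [← mem_rejectedOffers, hR.eq]

theorem rejectedOffers_subset_of_offers_le (hC : IsRegularChoice (jointChoice C))
    (h : offers σ' R' ≤ offers σ R) : rejectedOffers C σ' R' ⊆ rejectedOffers C σ R := by
  rintro ⟨i, x⟩ hp
  obtain ⟨hi, hi'⟩ := mem_rejectedOffers.1 hp
  exact mem_rejectedOffers.2 ⟨h x hi, fun hc => hi' (hC.mem_of_le h hi hc)⟩

theorem rejectedOffers_mono (hC : IsRegularChoice (jointChoice C)) :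
    Monotone (rejectedOffers C σ) :=
  fun _ _ h => rejectedOffers_subset_of_offers_le hC (offers_mono h)

variable [DecidableEq S]

theorem mem_daRound : (i, x) ∈ daRound C σ R ↔
    (i, x) ∈ R ∨ i ∈ applicants σ R x ∧ i ∉ jointChoice C (applicants σ R) x := by
  simp only [daRound, mem_union, mem_filter, mem_univ, true_and]
  rfl

theorem daRound_subset (hC : IsRegularChoice (jointChoice C)) :
    daRound C σ R ⊆ R ∪ rejectedOffers C σ R := by
  rintro ⟨i, x⟩ hp
  rcases mem_daRound.1 hp with hp | ⟨hi, hi'⟩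
  · exact mem_union_left _ hp
  · refine mem_union_right _ (mem_rejectedOffers.2 ⟨applicants_le_offers x hi, fun hc => hi' ?_⟩)
    exact hC.mem_of_le applicants_le_offers hi hc

theorem daRejections_subset (hC : IsRegularChoice (jointChoice C))
    (hR : rejectedOffers C σ R ⊆ R) : daRejections C σ ⊆ R :=
  Iterate.rec (· ⊆ R) (empty_subset R)
    (fun _ hQ => (daRound_subset hC).trans (union_subset hQ ((rejectedOffers_mono hC hQ).trans hR)))
    _

theorem daRejections_subset_rejectedOffers (hC : IsRegularChoice (jointChoice C)) :
    daRejections C σ ⊆ rejectedOffers C σ (daRejections C σ) :=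
  Iterate.rec (fun Q => Q ⊆ rejectedOffers C σ Q) (empty_subset _)
    (fun _ hQ => ((daRound_subset hC).trans (union_subset hQ subset_rfl)).trans
      (rejectedOffers_mono hC subset_union_left))
    _

theorem isFixedPt_daRejections (hC : IsRegularChoice (jointChoice C)) (σ : I → PrefList S) :
    IsFixedPt (rejectedOffers C σ) (daRejections C σ) := by
  have hpost := daRejections_subset_rejectedOffers hC (σ := σ)
  have hround := daRound_daRejections C σ
  generalize daRejections C σ = R at hpost hround
  refine subset_antisymm ?_ hpost
  rintro ⟨i, x⟩ hp
  obtain ⟨hi, hi'⟩ := mem_rejectedOffers.1 hp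
  have hchoice : jointChoice C (applicants σ R) = jointChoice C (offers σ R) :=
    hC.eq_of_le applicants_le_offers fun y j hj => mem_applicants.2
      ⟨hC.le _ y hj, fun hjR => (mem_rejectedOffers.1 (hpost hjR)).2 hj⟩
  by_contra hR
  rw [← hround, mem_daRound, hchoice] at hR
  exact hR (Or.inr ⟨mem_applicants.2 ⟨hi, fun h => hR (Or.inl h)⟩, hi'⟩)

theorem applicants_of_isFixedPt (hC : IsRegularChoice (jointChoice C))
    (hR : IsFixedPt (rejectedOffers C σ) R) :
    applicants σ R = jointChoice C (offers σ R) := by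
  ext x i
  have hle : i ∈ jointChoice C (offers σ R) x → i ∈ offers σ R x := fun h => hC.le _ x h
  rw [mem_applicants, mem_iff_of_isFixedPt hR]
  tauto

theorem jointChoice_applicants_of_isFixedPt (hC : IsRegularChoice (jointChoice C))
    (hR : IsFixedPt (rejectedOffers C σ) R) {Y : Subschool S → Finset I}
    (hY : Y ≤ offers σ R) (happ : applicants σ R ≤ Y) :
    jointChoice C Y = applicants σ R := by
  rw [applicants_of_isFixedPt hC hR] at happ ⊢
  exact hC.eq_of_le hY happ

theorem daRejections_subset_of_offers_le (hC : IsRegularChoice (jointChoice C))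
    (hR : IsFixedPt (rejectedOffers C σ) R) (hoffers : offers σ' R' ≤ offers σ R)
    (hmem : ∀ j y, (j, y) ∈ R → j ∈ offers σ' R' y → (j, y) ∈ R') : daRejections C σ' ⊆ R' := by
  refine daRejections_subset hC ?_
  rintro ⟨j, y⟩ hp
  exact hmem j y (hR ▸ rejectedOffers_subset_of_offers_le hC hoffers hp) (mem_rejectedOffers.1 hp).1

theorem isFixedPt_of_offers_le (hC : IsRegularChoice (jointChoice C))
    (hR : IsFixedPt (rejectedOffers C σ) R) (hoffers : offers σ' R' ≤ offers σ R)
    (happ : applicants σ R ≤ offers σ' R')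
    (hmem : ∀ j y, (j, y) ∈ R' ↔ (j, y) ∈ R ∧ j ∈ offers σ' R' y) :
    IsFixedPt (rejectedOffers C σ') R' := by
  ext ⟨j, y⟩
  have hle := @hoffers y j
  rw [mem_rejectedOffers, jointChoice_applicants_of_isFixedPt hC hR hoffers happ, mem_applicants,
    hmem]
  tauto

/-- The rural hospitals theorem: a fixed point `R` contains the least one, so that no more students
are unmatched at the latter; but the number of selected students is monotone in `R`. -/
theorem offer_eq_none_iff_of_isFixedPt (hC : IsRegularChoice (jointChoice C))
    (hR : IsFixedPt (rejectedOffers C σ) R) :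
    offer σ R i = none ↔ deferredAcceptance C σ i = none := by
  have hR₀ := isFixedPt_daRejections hC σ
  have hsub : daRejections C σ ⊆ R := daRejections_subset hC hR.le
  have hmatched : ({j | offer σ R j ≠ none} : Finset I) ⊆
      ({j | deferredAcceptance C σ j ≠ none} : Finset I) := by
    refine monotone_filter_right _ fun j _ => mt fun hj => ?_
    exact offer_eq_none_iff.2 fun a ha => hsub (offer_eq_none_iff.1 hj a ha)
  have hcard : #{j | deferredAcceptance C σ j ≠ none} ≤ #{j | offer σ R j ≠ none} := by
    rw [deferredAcceptance, ← Matching.sum_card_holders, ← Matching.sum_card_holders,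
      holders_offer, holders_offer, applicants_of_isFixedPt hC hR, applicants_of_isFixedPt hC hR₀]
    exact hC.sum_card_mono (offers_mono hsub)
  simpa [not_iff_not] using Finset.ext_iff.1 (eq_of_subset_of_card_le hmatched hcard) i

theorem deferredAcceptance_eq_some_iff : deferredAcceptance C σ i = some x ↔
    i ∈ offers σ (daRejections C σ) x ∧ (i, x) ∉ daRejections C σ :=
  offer_eq_some_iff

theorem mem_list_of_deferredAcceptance (h : deferredAcceptance C σ i = some x) : x ∈ (σ i).1 :=
  List.mem_of_find?_eq_some h

theorem jointChoice_holders_deferredAcceptance (hC : IsRegularChoice (jointChoice C)) :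
    jointChoice C (Matching.holders (deferredAcceptance C σ)) =
      Matching.holders (deferredAcceptance C σ) :=
  jointChoice_applicants_of_isFixedPt hC (isFixedPt_daRejections hC σ) applicants_le_offers le_rfl

end FixedPoint

section StrategyProofness

variable {I S : Type*}

/-- The list that contains only the given subschool, if any. -/
def PrefList.ofOption (o : Option (Subschool S)) : PrefList S :=
  ⟨o.toList, by cases o <;> simp⟩

theorem mem_offers_of_eq_ofOption [Fintype I] {σ : I → PrefList S} {R : Finset (I × Subschool S)}
    {i : I} {x : Subschool S} {o : Option (Subschool S)} (h : σ i = PrefList.ofOption o) :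
    i ∈ offers σ R x ↔ o = some x := by
  rw [mem_offers, h, PrefList.ofOption]
  cases o with
  | none => simp
  | some y =>
    rw [Option.some_inj]
    constructor
    · rintro ⟨as, has, -⟩
      exact (List.mem_singleton.1 (has.subset (by simp))).symm
    · rintro rfl
      exact ⟨[], List.prefix_rfl, by simp⟩

variable [Fintype I] [DecidableEq I] [Fintype S] [DecidableEq S]
  {C : S → ChoiceRule I} {σ : I → PrefList S} {i : I} {x : Subschool S}

theorem deferredAcceptance_update_single_eq_some (hC : IsRegularChoice (jointChoice C))
    (h : deferredAcceptance C σ i = some x) :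
    deferredAcceptance C (update σ i (.ofOption (some x))) i = some x := by
  obtain ⟨hi, hx⟩ := deferredAcceptance_eq_some_iff.1 h
  set σ' := update σ i (.ofOption (some x))
  have hself {R y} : i ∈ offers σ' R y ↔ x = y := by
    rw [mem_offers_of_eq_ofOption (update_self ..), Option.some_inj]
  set R' := {p ∈ daRejections C σ | p.1 ≠ i}
  have hoffers : offers σ' R' ≤ offers σ (daRejections C σ) := by
    intro y j hj
    by_cases hji : j = i
    · subst hji
      exact hself.1 hj ▸ hi
    · exact mem_offers_of_forall (update_of_ne hji ..) (fun a ha => (mem_filter.1 ha).1) hj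
  have hsub : daRejections C σ' ⊆ R' := by
    refine daRejections_subset_of_offers_le hC (isFixedPt_daRejections hC σ) hoffers ?_
    refine fun j y hj hoff => mem_filter.2 ⟨hj, ?_⟩
    rintro rfl
    exact hx (hself.1 hoff ▸ hj)
  exact deferredAcceptance_eq_some_iff.2 ⟨hself.2 rfl, fun h => (mem_filter.1 (hsub h)).2 rfl⟩

theorem isFixedPt_rejectedOffers_update_single (hC : IsRegularChoice (jointChoice C))
    {R : Finset (I × Subschool S)} (hR : IsFixedPt (rejectedOffers C σ) R)
    (hi : offer σ R i = none) (hx : (i, x) ∈ R) :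
    IsFixedPt (rejectedOffers C (update σ i (.ofOption (some x)))) {p ∈ R | p.1 = i → p.2 = x} := by
  set σ' := update σ i (.ofOption (some x))
  set R' := {p ∈ R | p.1 = i → p.2 = x}
  have hself {y} : i ∈ offers σ' R' y ↔ x = y := by
    rw [mem_offers_of_eq_ofOption (update_self ..), Option.some_inj]
  have hother {j} (hj : j ≠ i) {y} : j ∈ offers σ' R' y ↔ j ∈ offers σ R y :=
    ⟨mem_offers_of_forall (update_of_ne hj ..) fun a ha => (mem_filter.1 ha).1,
      mem_offers_of_forall (update_of_ne hj ..).symm fun a ha => mem_filter.2 ⟨ha, by simp [hj]⟩⟩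
  have hoffers : offers σ' R' ≤ offers σ R := by
    intro y j hj
    by_cases hji : j = i
    · subst hji
      exact hself.1 hj ▸ ((mem_iff_of_isFixedPt hR).1 hx).1
    · exact (hother hji).1 hj
  have happ : applicants σ R ≤ offers σ' R' := by
    intro y j hj
    have hji : j ≠ i := by
      rintro rfl
      exact Option.some_ne_none y ((mem_filter.1 hj).2.symm.trans hi)
    exact (hother hji).2 (applicants_le_offers y hj)
  refine isFixedPt_of_offers_le hC hR hoffers happ fun j y => ?_
  rw [mem_filter, and_congr_right_iff]
  intro hj
  by_cases hji : j = i
  · subst hji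
    simp [hself, eq_comm]
  · simp [hji, hother hji, ((mem_iff_of_isFixedPt hR).1 hj).1]

theorem deferredAcceptance_update_single_eq_none (hC : IsRegularChoice (jointChoice C))
    (hx : x ∈ (σ i).1) (h : deferredAcceptance C σ i = none) :
    deferredAcceptance C (update σ i (.ofOption (some x))) i = none := by
  have hxR : (i, x) ∈ daRejections C σ := offer_eq_none_iff.1 h x hx
  rw [← offer_eq_none_iff_of_isFixedPt hC
    (isFixedPt_rejectedOffers_update_single hC (isFixedPt_daRejections hC σ) h hxR)]
  simpa [offer_eq_none_iff, PrefList.ofOption] using hxR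

theorem deferredAcceptance_update_of_prefix (hC : IsRegularChoice (jointChoice C))
    {L : PrefList S} (hL : (σ i).1 <+: L.1) (h : deferredAcceptance C σ i ≠ none) :
    ∃ z ∈ (σ i).1, deferredAcceptance C (update σ i L) i = some z := by
  obtain ⟨z, hz⟩ := Option.ne_none_iff_exists'.1 h
  have hzmem := mem_list_of_deferredAcceptance hz
  have hzR := (deferredAcceptance_eq_some_iff.1 hz).2
  have hoffers : offers (update σ i L) (daRejections C σ) ≤ offers σ (daRejections C σ) := by
    intro y j hj
    by_cases hji : j = i
    · subst hji
      exact (mem_offers_iff_of_prefix (by rwa [update_self]) hzmem hzR).1 hj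
    · exact mem_offers_of_forall (update_of_ne hji ..) (fun _ => id) hj
  have hsub : daRejections C (update σ i L) ⊆ daRejections C σ :=
    daRejections_subset_of_offers_le hC (isFixedPt_daRejections hC σ) hoffers fun _ _ hj _ => hj
  have hne : offer σ (daRejections C (update σ i L)) i ≠ none :=
    fun hnone => hzR (hsub (offer_eq_none_iff.1 hnone z hzmem))
  obtain ⟨w, hw⟩ := Option.ne_none_iff_exists'.1 hne
  obtain ⟨hwoff, hwR⟩ := offer_eq_some_iff.1 hw
  exact ⟨w, List.mem_of_find?_eq_some hw, deferredAcceptance_eq_some_iff.2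
    ⟨mem_offers_of_prefix (by rwa [update_self]) hwoff, hwR⟩⟩

theorem exists_deferredAcceptance_eq_some_of_prefix (hC : IsRegularChoice (jointChoice C))
    {L L' : PrefList S} {as : List (Subschool S)} (hL : as ++ [x] <+: L.1)
    (h : deferredAcceptance C (update σ i L') i = some x) :
    ∃ z ∈ as ++ [x], deferredAcceptance C (update σ i L) i = some z := by
  let K : PrefList S := ⟨as ++ [x], L.2.sublist hL.sublist⟩
  have hsingle := deferredAcceptance_update_single_eq_some hC h
  have hK : deferredAcceptance C (update σ i K) i ≠ none := by
    intro hnone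
    have := deferredAcceptance_update_single_eq_none hC (x := x) (by simp [K]) hnone
    rw [update_idem] at this hsingle
    exact Option.some_ne_none x (hsingle.symm.trans this)
  simpa [K] using deferredAcceptance_update_of_prefix hC (L := L) (by simpa [K] using hL) hK

theorem isWeaklyDominant_of_consistentWith (hC : IsRegularChoice (jointChoice C))
    {P : Option S → Option S → Prop} [Std.Trichotomous P] [IsTrans (Option S) P]
    {L : PrefList S} (hL : L.ConsistentWith P) :
    IsWeaklyDominant (deferredAcceptance C) P i L := by
  intro σ L'
  have hrational :
      WeakPref P (Matching.school (deferredAcceptance C (update σ i L)) i) none := by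
    rw [Matching.school]
    cases hz : deferredAcceptance C (update σ i L) i with
    | none => exact Or.inr rfl
    | some z =>
      have hzL : z ∈ L.1 := by simpa using mem_list_of_deferredAcceptance hz
      exact Or.inl ((hL.mem_iff z.1 z.2).1 hzL)
  cases hx : deferredAcceptance C (update σ i L') i with
  | none => simpa [Matching.school, hx] using hrational
  | some x =>
    have hx' : Matching.school (deferredAcceptance C (update σ i L')) i = some x.1 := by
      rw [Matching.school, hx, Option.map_some]
    rw [hx']
    by_cases hxL : x ∈ L.1
    · obtain ⟨as, bs, hLx⟩ := List.append_of_mem hxL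
      obtain ⟨z, hzas, hz⟩ := exists_deferredAcceptance_eq_some_of_prefix hC
        (L := L) (as := as) ⟨bs, by simp [hLx]⟩ hx
      rw [Matching.school, hz, Option.map_some]
      by_cases hzx : z.1 = x.1
      · exact Or.inr (congrArg some hzx)
      have hzas' : z ∈ as := by
        refine (List.mem_append.1 hzas).resolve_right fun h => hzx ?_
        rw [List.mem_singleton.1 h]
      have hord := hL.order
      rw [hLx, List.pairwise_append] at hord
      exact Or.inl (hord.2.2 z hzas' x (by simp) hzx)
    · have hxnone : P none (some x.1) :=
        ((trichotomous_of P none (some x.1)).resolve_right fun h => h.elim nofun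
          fun h => hxL ((hL.mem_iff x.1 x.2).2 h))
      rcases hrational with h | h
      · exact Or.inl (_root_.trans h hxnone)
      · exact Or.inl (h ▸ hxnone)

end StrategyProofness

section Dominance

variable {I S : Type*}

/-- The strategy profile in which each student lists only her assignment in `μ`. -/
def Matching.profile (μ : Matching I S) (i : I) : PrefList S := .ofOption (μ i)

variable [DecidableEq I]

theorem Matching.update_profile (μ : Matching I S) (i : I) (o : Option (Subschool S)) :
    update μ.profile i (.ofOption o) = Matching.profile (update μ i o) :=
  (comp_update PrefList.ofOption μ i o).symm

variable [Fintype I] [Fintype S] [DecidableEq S] {C : S → ChoiceRule I} {σ : I → PrefList S}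
  {i : I} {x : Subschool S}

theorem holders_deferredAcceptance_profile (hC : IsRegularChoice (jointChoice C))
    (μ : Matching I S) :
    Matching.holders (deferredAcceptance C μ.profile) = jointChoice C μ.holders := by
  have hoffers : offers μ.profile (daRejections C μ.profile) = μ.holders := by
    ext x i
    rw [mem_offers_of_eq_ofOption (σ := μ.profile) (o := μ i) rfl, Matching.mem_holders]
  rw [← hoffers]
  exact applicants_of_isFixedPt hC (isFixedPt_daRejections hC _)

theorem daRejections_update_profile_subset (hC : IsRegularChoice (jointChoice C)) :
    daRejections C (update (Matching.profile (deferredAcceptance C σ)) i (σ i)) ⊆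
      {p ∈ daRejections C σ | p.1 = i} := by
  have hother {R j} (hj : j ≠ i) {y} :
      j ∈ offers (update (Matching.profile (deferredAcceptance C σ)) i (σ i)) R y ↔
        j ∈ applicants σ (daRejections C σ) y := by
    rw [mem_offers_of_eq_ofOption (update_of_ne hj ..), ← holders_offer, Matching.mem_holders]
    rfl
  refine daRejections_subset_of_offers_le hC (isFixedPt_daRejections hC σ) ?_ ?_
  · intro y j hj
    by_cases hji : j = i
    · subst hji
      exact mem_offers_of_forall (update_self ..) (fun a ha => (mem_filter.1 ha).1) hj
    · exact applicants_le_offers y ((hother hji).1 hj)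
  · intro j y hj hoff
    refine mem_filter.2 ⟨hj, ?_⟩
    by_contra hji
    exact (mem_applicants.1 ((hother hji).1 hoff)).2 hj

theorem notMem_jointChoice_insert_of_mem_offers (hC : IsRegularChoice (jointChoice C))
    (hi : i ∈ offers σ (daRejections C σ) x) (hx : deferredAcceptance C σ i ≠ some x) :
    i ∉ jointChoice C (update (Matching.holders (deferredAcceptance C σ)) x
      (insert i (Matching.holders (deferredAcceptance C σ) x))) x := by
  rw [jointChoice_applicants_of_isFixedPt hC (isFixedPt_daRejections hC σ) ?_ ?_]
  · exact fun h => hx (mem_filter.1 h).2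
  · intro y j hj
    rcases Matching.mem_update_insert_holders.1 hj with hj | ⟨rfl, rfl⟩
    · exact (deferredAcceptance_eq_some_iff.1 hj).1
    · exact hi
  · exact fun y j hj => Matching.mem_update_insert_holders.2 (Or.inl (mem_filter.1 hj).2)

theorem school_deferredAcceptance_update_profile (hC : IsRegularChoice (jointChoice C))
    (σ : I → PrefList S) (i : I) :
    Matching.school (deferredAcceptance C
      (update (Matching.profile (deferredAcceptance C σ)) i (σ i))) i =
    Matching.school (deferredAcceptance C σ) i := by
  have hsub := daRejections_update_profile_subset hC (σ := σ) (i := i)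
  set τ := update (Matching.profile (deferredAcceptance C σ)) i (σ i)
  have hτi : τ i = σ i := update_self ..
  have hrej {a} (ha : (i, a) ∈ daRejections C τ) : (i, a) ∈ daRejections C σ :=
    (mem_filter.1 (hsub ha)).1
  cases hz : deferredAcceptance C τ i with
  | none =>
    have hnone : deferredAcceptance C σ i = none :=
      offer_eq_none_iff.2 fun a ha => hrej (offer_eq_none_iff.1 hz a (hτi ▸ ha))
    simp only [Matching.school, hz, hnone]
  | some z =>
    by_contra hne
    rw [Matching.school, hz, Option.map_some, eq_comm] at hne
    have hzoff := (deferredAcceptance_eq_some_iff.1 hz).1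
    have hchosen : i ∈ jointChoice C (offers τ (daRejections C τ)) z := by
      rw [← applicants_of_isFixedPt hC (isFixedPt_daRejections hC τ)]
      exact Matching.mem_holders.2 hz
    have hle : Matching.holders (update (deferredAcceptance C σ) i (some z)) ≤
        offers τ (daRejections C τ) :=
      Matching.holders_update_le hzoff fun j y hj hy =>
        (mem_offers_of_eq_ofOption (update_of_ne hj ..)).2 hy
    have hchosen' := hC.mem_of_le hle (Matching.mem_holders.2 (update_self ..)) hchosen
    rw [Matching.jointChoice_holders_update hne] at hchosen'
    refine notMem_jointChoice_insert_of_mem_offers hC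
      (mem_offers_of_forall hτi (fun _ => hrej) hzoff) (fun h => hne ?_) hchosen'
    rw [Matching.school, h, Option.map_some]

theorem notMem_jointChoice_insert_of_isWeaklyDominant (hC : IsRegularChoice (jointChoice C))
    {P : Option S → Option S → Prop} [Std.Asymm P]
    (hi : IsWeaklyDominant (deferredAcceptance C) P i (σ i))
    (hx : P (some x.1) (Matching.school (deferredAcceptance C σ) i)) :
    i ∉ jointChoice C (update (Matching.holders (deferredAcceptance C σ)) x
      (insert i (Matching.holders (deferredAcceptance C σ) x))) x := by
  have hne : Matching.school (deferredAcceptance C σ) i ≠ some x.1 :=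
    fun h => asymm_of P (h ▸ hx) (h ▸ hx)
  intro hchosen
  rw [← Matching.jointChoice_holders_update hne, ← holders_deferredAcceptance_profile hC,
    ← Matching.update_profile, Matching.mem_holders] at hchosen
  have hsingle : Matching.school (deferredAcceptance C
      (update (Matching.profile (deferredAcceptance C σ)) i (.ofOption (some x)))) i =
      some x.1 := by
    rw [Matching.school, hchosen, Option.map_some]
  have hdom := hi (Matching.profile (deferredAcceptance C σ)) (.ofOption (some x))
  rw [school_deferredAcceptance_update_profile hC, hsingle] at hdom
  exact hdom.elim (asymm_of P hx) hne

theorem isPairwiseStable_deferredAcceptance (hC : IsRegularChoice (jointChoice C))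
    {P : I → Option S → Option S → Prop} [∀ i, Std.Asymm (P i)]
    (hσ : ∀ i, IsWeaklyDominant (deferredAcceptance C) (P i) i (σ i)) :
    Matching.IsPairwiseStable C P (deferredAcceptance C σ) where
  individuallyRational i := by
    have hempty : Matching.school (deferredAcceptance C (update σ i (.ofOption none))) i = none :=
      Option.map_eq_none_iff.2 (offer_eq_none_iff.2 (by simp [PrefList.ofOption]))
    have hdom := hσ i σ (.ofOption none)
    rwa [update_eq_self, hempty] at hdom
  jointChoice_holders := jointChoice_holders_deferredAcceptance hC
  notMem_jointChoice_insert i _ := notMem_jointChoice_insert_of_isWeaklyDominant hC (hσ i)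

end Dominance

namespace Problem

variable {I S M : Type*} [Fintype I] [Fintype M] [DecidableEq M] {E : Problem I S M}
  {s : S} {A B : Finset I} {i : I} {n k : ℕ}

theorem mem_top : i ∈ E.top s n A ↔ i ∈ A ∧ #{j ∈ A | E.π i s < E.π j s} < n :=
  mem_filter

theorem top_subset : E.top s n A ⊆ A := filter_subset _ _

theorem mem_top_of_subset (h : A ⊆ B) (hkn : k ≤ n) (hi : i ∈ A) (hB : i ∈ E.top s k B) :
    i ∈ E.top s n A :=
  mem_top.2 ⟨hi, ((card_le_card (filter_subset_filter _ h)).trans_lt (mem_top.1 hB).2).trans_le hkn⟩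

theorem card_top (E : Problem I S M) (s : S) (n : ℕ) (A : Finset I) :
    #(E.top s n A) = min n #A := by
  classical
  induction A using induction_on_min_value (E.π · s) with
  | empty => simp [top]
  | insert a A ha hmin ih =>
    have hrank_a : #{j ∈ insert a A | E.π a s < E.π j s} = #A := by
      have hlt : ∀ j ∈ A, E.π a s < E.π j s := fun j hj =>
        (hmin j hj).lt_of_ne fun h => ha (E.π_inj s h ▸ hj)
      rw [filter_insert, if_neg (lt_irrefl _), filter_true_of_mem hlt]
    have hrank : ∀ i ∈ A, #{j ∈ insert a A | E.π i s < E.π j s} = #{j ∈ A | E.π i s < E.π j s} :=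
      fun i hi => by rw [filter_insert, if_neg (hmin i hi).not_gt]
    have htop : E.top s n (insert a A) =
        if #A < n then insert a (E.top s n A) else E.top s n A := by
      rw [top, filter_insert, hrank_a, filter_congr fun i hi => by rw [hrank i hi], top]
    rw [htop, card_insert_of_notMem ha]
    split_ifs with h
    · rw [card_insert_of_notMem fun h => ha (top_subset h), ih]
      omega
    · omega

variable [DecidableEq I]

theorem card_eq_and_forall_of_notMem_top_insert (hi : i ∉ E.top s n (insert i A)) (hA : #A ≤ n) :
    #A = n ∧ ∀ j ∈ A, E.π i s < E.π j s := by
  have hrank : n ≤ #{j ∈ A | E.π i s < E.π j s} := by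
    simpa [mem_top, filter_insert] using hi
  have hle := card_filter_le A fun j => E.π i s < E.π j s
  exact ⟨by omega, card_filter_eq_iff.1 (by omega)⟩

theorem mem_chooseReserved :
    i ∈ E.chooseReserved s A ↔ i ∈ E.top s (E.qr s (E.τ i)) {j ∈ A | E.τ j = E.τ i} := by
  simp only [chooseReserved, mem_biUnion, mem_univ, true_and]
  refine ⟨fun ⟨m, hm⟩ => ?_, fun h => ⟨_, h⟩⟩
  obtain rfl : E.τ i = m := (mem_filter.1 (top_subset hm)).2
  exact hm

theorem chooseReserved_subset : E.chooseReserved s A ⊆ A :=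
  fun _ hi => (mem_filter.1 (top_subset (mem_chooseReserved.1 hi))).1

theorem filter_chooseReserved (E : Problem I S M) (s : S) (A : Finset I) (m : M) :
    {i ∈ E.chooseReserved s A | E.τ i = m} = E.top s (E.qr s m) {i ∈ A | E.τ i = m} := by
  ext i
  rw [mem_filter, mem_chooseReserved]
  refine ⟨?_, fun h => ?_⟩
  · rintro ⟨h, rfl⟩
    exact h
  · obtain rfl : E.τ i = m := (mem_filter.1 (top_subset h)).2
    exact ⟨h, rfl⟩

theorem card_chooseReserved (E : Problem I S M) (s : S) (A : Finset I) :
    #(E.chooseReserved s A) = ∑ m, min (E.qr s m) #{i ∈ A | E.τ i = m} := by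
  rw [card_eq_sum_card_fiberwise (f := E.τ) (t := univ) (by simp)]
  exact sum_congr rfl fun m _ => by rw [filter_chooseReserved, card_top]

theorem mem_chooseReserved_of_subset (h : A ⊆ B) (hi : i ∈ A) (hB : i ∈ E.chooseReserved s B) :
    i ∈ E.chooseReserved s A :=
  mem_chooseReserved.2 (mem_top_of_subset (filter_subset_filter _ h) le_rfl (by simp [hi])
    (mem_chooseReserved.1 hB))

theorem card_chooseReserved_mono (E : Problem I S M) (s : S) :
    Monotone fun A => #(E.chooseReserved s A) := by
  intro A B h
  simp only [card_chooseReserved]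
  exact sum_le_sum fun m _ => min_le_min_left _ (card_le_card (filter_subset_filter _ h))

theorem card_chooseReserved_le (E : Problem I S M) (s : S) (A : Finset I) :
    #(E.chooseReserved s A) ≤ E.q s := by
  rw [card_chooseReserved]
  exact (sum_le_sum fun m _ => min_le_left _ _).trans (E.sum_qr_lt s).le

theorem isRegularChoice_choiceSep (E : Problem I S M) (s : S) :
    IsRegularChoice (E.choiceSep s).select where
  le
    | _, .opn => top_subset
    | _, .res => chooseReserved_subset
  mem_of_le {_ _ t _} h hi hB := by
    cases t with
    | opn => exact mem_top_of_subset (h .opn) le_rfl hi hB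
    | res => exact mem_chooseReserved_of_subset (h .res) hi hB
  sum_card_mono A B h := by
    refine sum_le_sum fun t _ => ?_
    cases t with
    | opn =>
      simp only [ChoiceRule.select, choiceSep, card_top]
      exact min_le_min_left _ (card_le_card (h .opn))
    | res => exact E.card_chooseReserved_mono s (h .res)

theorem isRegularChoice_choiceFlex (E : Problem I S M) (s : S) :
    IsRegularChoice (E.choiceFlex s).select where
  le
    | _, .opn => top_subset
    | _, .res => chooseReserved_subset
  mem_of_le {_ _ t _} h hi hB := by
    cases t with
    | opn =>
      have hle := Nat.sub_le_sub_left (E.card_chooseReserved_mono s (h .res)) (E.q s)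
      exact mem_top_of_subset (h .opn) hle hi hB
    | res => exact mem_chooseReserved_of_subset (h .res) hi hB
  sum_card_mono A B h := by
    have hopn := card_le_card (h .opn)
    have hres : #(E.chooseReserved s (A .res)) ≤ #(E.chooseReserved s (B .res)) :=
      E.card_chooseReserved_mono s (h .res)
    have hle := E.card_chooseReserved_le s (B .res)
    have hsum (f : Seat → ℕ) : ∑ t, f t = f .opn + f .res := rfl
    simp only [hsum, ChoiceRule.select, choiceFlex, card_top]
    omega

section Stability

variable [DecidableEq S] {μ : Matching I S} {P : I → Option S → Option S → Prop}

theorem chooseReserved_holders (h : jointChoice E.choiceFlex μ.holders = μ.holders) (s : S) :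
    E.chooseReserved s (μ.holders (s, Seat.res)) = μ.holders (s, Seat.res) :=
  congrFun h (s, Seat.res)

theorem card_holders_opn_le (h : jointChoice E.choiceFlex μ.holders = μ.holders) (s : S) :
    #(μ.holders (s, Seat.opn)) ≤ E.q s - #(μ.holders (s, Seat.res)) := by
  have hopn : E.top s (E.q s - #(E.chooseReserved s (μ.holders (s, Seat.res))))
      (μ.holders (s, Seat.opn)) = μ.holders (s, Seat.opn) := congrFun h (s, Seat.opn)
  rw [chooseReserved_holders h] at hopn
  rw [← hopn, card_top]
  exact min_le_left _ _

theorem card_reservedOf_le (h : jointChoice E.choiceFlex μ.holders = μ.holders) (s : S) (m : M) :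
    #(μ.reservedOf E.τ s m) ≤ E.qr s m := by
  rw [μ.reservedOf_eq, ← chooseReserved_holders h, filter_chooseReserved, card_top]
  exact min_le_left _ _

theorem card_holders_res_le (h : jointChoice E.choiceFlex μ.holders = μ.holders) (s : S) :
    #(μ.holders (s, Seat.res)) ≤ E.q s :=
  chooseReserved_holders h s ▸ E.card_chooseReserved_le s _

theorem isFeasible_of_jointChoice_eq (h : jointChoice E.choiceFlex μ.holders = μ.holders) :
    E.IsFeasible μ := by
  refine ⟨fun s => ?_, card_reservedOf_le h⟩
  have hopn := card_holders_opn_le h s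
  have hres := card_holders_res_le h s
  rw [μ.card_admitted]
  omega

theorem card_holders_opn_of_pref (h : μ.IsPairwiseStable E.choiceFlex P)
    (hs : P i (some s) (μ.school i)) :
    #(μ.holders (s, Seat.opn)) = E.q s - #(μ.holders (s, Seat.res)) ∧
      ∀ j ∈ μ.holders (s, Seat.opn), E.π i s < E.π j s := by
  refine card_eq_and_forall_of_notMem_top_insert ?_ (card_holders_opn_le h.jointChoice_holders s)
  simpa [jointChoice, ChoiceRule.select, choiceFlex, chooseReserved_holders h.jointChoice_holders]
    using h.notMem_jointChoice_insert i (s, Seat.opn) hs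

theorem card_reservedOf_of_pref (h : μ.IsPairwiseStable E.choiceFlex P)
    (hs : P i (some s) (μ.school i)) :
    #(μ.reservedOf E.τ s (E.τ i)) = E.qr s (E.τ i) ∧
      ∀ j ∈ μ.reservedOf E.τ s (E.τ i), E.π i s < E.π j s := by
  refine card_eq_and_forall_of_notMem_top_insert ?_ (card_reservedOf_le h.jointChoice_holders s _)
  simpa [jointChoice, ChoiceRule.select, choiceFlex, mem_chooseReserved, filter_insert,
    Matching.reservedOf_eq] using h.notMem_jointChoice_insert i (s, Seat.res) hs

theorem isStable_of_isPairwiseStable (h : μ.IsPairwiseStable E.choiceFlex P) : E.IsStable P μ where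
  feasible := isFeasible_of_jointChoice_eq h.jointChoice_holders
  individuallyRational := h.individuallyRational
  nonWasteful i s hs := by
    have hopn := (card_holders_opn_of_pref h hs).1
    have hres := card_holders_res_le h.jointChoice_holders s
    rw [μ.card_admitted]
    omega
  reserveNonWasteful i s hs := (card_reservedOf_of_pref h hs).1
  noJustifiedEnvy := by
    rintro i j ⟨s, hj, hs, hlt, htype⟩
    obtain ⟨⟨s, t⟩, hjt, rfl⟩ := Option.map_eq_some_iff.1 hj
    cases t with
    | opn => exact hlt.asymm ((card_holders_opn_of_pref h hs).2 j (Matching.mem_holders.2 hjt))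
    | res =>
      have hτ : E.τ j = E.τ i := (htype.resolve_right (by simp [hjt])).symm
      exact hlt.asymm ((card_reservedOf_of_pref h hs).2 j (mem_filter.2 ⟨mem_univ j, hjt, hτ⟩))

end Stability

end Problem

end SchoolChoice

theorem mainTheorem6 {I S M : Type*} [Fintype I] [DecidableEq I] [Fintype S] [DecidableEq S]
    [Fintype M] [DecidableEq M] (E : SchoolChoice.Problem I S M)
    (P : I → Option S → Option S → Prop) (hP : ∀ i, IsStrictTotalOrder (Option S) (P i)) :
    -- submitting a consistent list is weakly dominant in SimSep and in SimFlex
    (∀ (i : I) (L : SchoolChoice.PrefList S), L.ConsistentWith (P i) →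
      SchoolChoice.IsWeaklyDominant E.simSep (P i) i L ∧
      SchoolChoice.IsWeaklyDominant E.simFlex (P i) i L) ∧
    -- if all students submit consistent lists, SimFlex yields a stable matching
    (∀ σ : I → SchoolChoice.PrefList S, (∀ i, (σ i).ConsistentWith (P i)) →
      E.IsStable P (E.simFlex σ)) ∧
    -- more generally, this holds if all students play weakly dominant strategies
    (∀ σ : I → SchoolChoice.PrefList S,
      (∀ i, SchoolChoice.IsWeaklyDominant E.simFlex (P i) i (σ i)) →
      E.IsStable P (E.simFlex σ)) := by
  have hsep := SchoolChoice.isRegularChoice_jointChoice E.isRegularChoice_choiceSep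
  have hflex := SchoolChoice.isRegularChoice_jointChoice E.isRegularChoice_choiceFlex
  have hstable : ∀ σ : I → SchoolChoice.PrefList S,
      (∀ i, SchoolChoice.IsWeaklyDominant E.simFlex (P i) i (σ i)) → E.IsStable P (E.simFlex σ) :=
    fun σ hσ => SchoolChoice.Problem.isStable_of_isPairwiseStable
      (SchoolChoice.isPairwiseStable_deferredAcceptance hflex hσ)
  exact ⟨fun i L hL => ⟨SchoolChoice.isWeaklyDominant_of_consistentWith hsep hL,
      SchoolChoice.isWeaklyDominant_of_consistentWith hflex hL⟩,
    fun σ hσ => hstable σ fun i => SchoolChoice.isWeaklyDominant_of_consistentWith hflex (hσ i),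
    hstable⟩
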